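/- Let $m,n\ge 0$ be integers with $m+n\ge 1$, let $r_i,\lambda_{1,i}>0$ ($1\le i\le m$), $\lambda_{2,j}>0$ and $\mu_j\in(0,1]$ ($1\le j\le n$). Let $$T=\sum_{i=1}^m Y_i+\sum_{j=1}^n Z_j,$$ where all the $Y_i$, $Z_j$ are independent, $Y_i$ has the gamma density $\frac{\lambda_{1,i}^{r_i}}{\Gamma(r_i)}x^{r_i-1}e^{-\lambda_{1,i}x}$ ($x>0$), and $Z_j$ has the Mittag-Leffler density $\lambda_{2,j}x^{\mu_j-1}E_{\mu_j,\mu_j}(-\lambda_{2,j}x^{\mu_j})$ ($x>0$), with $E_{\alpha,\beta}(z)=\sum_{k\ge0}z^k/\Gamma(\alpha k+\beta)$. For $s>0$ put ${}_0I_t^sf(t)=\frac1{\Gamma(s)}\int_0^t(t-y)^{s-1}f(y)\,dy$. For $r>0$ let ${}_0D_t^r f=\frac{d^N}{dt^N}\,{}_0I_t^{N-r}f$ with $N=\lfloor r\rfloor+1$ be the left Riemann–Liouville derivative; let ${}_0D_t^0$ be the identity and ${}_0D_t^{-s}={}_0I_t^s$ for $s>0$. Let ${}^{\alpha}_0R_t^r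 f(t)=e^{-\alpha t}\,{}_0D_t^r[e^{\alpha t}f(t)]$, and write $\bigodot_{i=1}^kL_i=L_k\circ\cdots\circ L_1$. Then $T$ has a density that is continuous on $(0,\infty)$, and this density $f_T$ (unique on $(0,\infty)$) lies in the domain of the operators below (at every step of the compositions, the fractional integrals converge absolutely and the derivatives exist classically on $(0,\infty)$) and satisfies $$\mathcal A_{m,n}\Big(\frac{d}{dt}\Big)[f_T](t):=\bigodot_{j=1}^n\big({}_0D_t^{\mu_j}+\lambda_{2,j}\big)\bigodot_{i=1}^m{}^{\lambda_{1,i}}_0R_t^{r_i}\,[f_T](t)=0\qquad(t>0).$$ Moreover, if $n\ge1$, then, with $\Lambda_{m,n}:=\prod_{i=1}^m\lambda_{1,i}^{r_i}\prod_{j=1}^n\lambda_{2,j}$, $$\lim_{t\to0+}\ {}_0D_t^{\mu_1-k}\bigodot_{j=2}^n\big({}_0D_t^{\mu_j}+\lambda_{2,j}\big)\bigodot_{i=1}^m{}^{\lambda_{1,i}}_0R_t^{r_i}\,[f_T](t)=\begin{cases}\Lambda_{m,n},&k=1,\\0,&2\le k\le\big\lceil\sum_{j=1}^n\mu_j+\sum_{i=1}^mr_i\big\rceil.\end{cases}$$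 -/

import Mathlib

open MeasureTheory ProbabilityTheory Set Filter Topology

noncomputable section

/-- The two-parameter Mittag-Leffler function `E_{α,β}(z) = ∑ z ^ k / Γ(α k + β)`
(real argument, positive real parameters). -/
def mittagLeffler (α β z : ℝ) : ℝ :=
  ∑' k : ℕ, z ^ k / Real.Gamma (α * k + β)

/-- The Mittag-Leffler probability density function with parameters `μ ∈ (0,1]` and `l > 0`. -/
def mittagLefflerPDFReal (μ l x : ℝ) : ℝ :=
  if 0 < x then l * x ^ (μ - 1) * mittagLeffler μ μ (-l * x ^ μ) else 0

/-- `f` is a probability density function (with respect to Lebesgue measure) of the real random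
variable `X` under `P`. -/
structure HasDensity {Ω : Type*} [MeasurableSpace Ω] (X : Ω → ℝ) (P : Measure Ω) (f : ℝ → ℝ) :
    Prop where
  aemeasurable : AEMeasurable X P
  aemeasurable_density : AEMeasurable f volume
  nonneg : 0 ≤ᵐ[volume] f
  map_eq : P.map X = volume.withDensity (fun x => ENNReal.ofReal (f x))

/-- A partially defined operator on real functions. Only the values of the functions on `(0, ∞)`
are relevant below. -/
structure PartialOp where
  /-- the functions to which the operator may be applied -/
  dom : Set (ℝ → ℝ)
  /-- the action of the operator (meaningful on `dom`) -/
  act : (ℝ → ℝ) → ℝ → ℝ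

namespace PartialOp

/-- The identity operator. -/
def id : PartialOp where
  dom := univ
  act f := f

/-- The composition `L ∘ M`, on its natural domain. -/
def comp (L M : PartialOp) : PartialOp where
  dom := {f | f ∈ M.dom ∧ M.act f ∈ L.dom}
  act f := L.act (M.act f)

/-- The operator `L + c`. -/
def addConst (L : PartialOp) (c : ℝ) : PartialOp where
  dom := L.dom
  act f t := L.act f t + c * f t

/-- The conjugated operator `f ↦ e^{-α t} L [e^{α t} f]`. -/
def conjExp (α : ℝ) (L : PartialOp) : PartialOp where
  dom := {f | (fun t => Real.exp (α * t) * f t) ∈ L.dom}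
  act f t := Real.exp (-α * t) * L.act (fun s => Real.exp (α * s) * f s) t

/-- The left-composition `L_{k-1} ∘ ⋯ ∘ L_0`. -/
def leftComp : {k : ℕ} → (Fin k → PartialOp) → PartialOp
  | 0, _ => PartialOp.id
  | k + 1, L => (L (Fin.last k)).comp (leftComp fun i : Fin k => L i.castSucc)

end PartialOp

/-- The left Riemann-Liouville fractional integral of order `s` with lower limit `0`. -/
def rlInt (s : ℝ) (f : ℝ → ℝ) (t : ℝ) : ℝ :=
  1 / Real.Gamma s * ∫ y in (0 : ℝ)..t, (t - y) ^ (s - 1) * f y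

/-- `f` is locally integrable on `[0, ∞)` and the integral defining `rlInt s f t` converges
absolutely for every `t > 0`. -/
def RLIntegrable (s : ℝ) (f : ℝ → ℝ) : Prop :=
  LocallyIntegrableOn f (Ici 0) ∧
    ∀ t : ℝ, 0 < t → IntervalIntegrable (fun y => (t - y) ^ (s - 1) * f y) volume 0 t

/-- The left fractional integral of order `s > 0` as an operator. -/
def rlIntOp (s : ℝ) : PartialOp where
  dom := {f | RLIntegrable s f}
  act := rlInt s

/-- The left Riemann-Liouville fractional derivative of order `r > 0` with lower limit `0`:
the classical `n`-th derivative of the fractional integral of order `n - r`, where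
`n = ⌊r⌋ + 1`. -/
def rlDerivOp (r : ℝ) : PartialOp where
  dom := {f | RLIntegrable ((⌊r⌋₊ + 1 : ℕ) - r) f ∧
    ContDiffOn ℝ (⌊r⌋₊ + 1 : ℕ) (rlInt ((⌊r⌋₊ + 1 : ℕ) - r) f) (Ioi 0)}
  act f := iteratedDeriv (⌊r⌋₊ + 1) (rlInt ((⌊r⌋₊ + 1 : ℕ) - r) f)

/-- `₀D_t^r` for every real order `r`: the fractional derivative for `r > 0`, the identity for
`r = 0` and the fractional integral of order `-r` for `r < 0`. -/
def rlOp (r : ℝ) : PartialOp :=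
  if 0 < r then rlDerivOp r else if r = 0 then PartialOp.id else rlIntOp (-r)

/-- The left fractional differential operator `f ↦ e^{-α t} ₀D_t^r [e^{α t} f]`. -/
def lfdo (α r : ℝ) : PartialOp :=
  (rlOp r).conjExp α

/-- The operator `𝒜_{m,n}(d/dt)`: all the `lfdo (l₁ i) (r i)` are applied first, and then all the
`₀D_t^{μ j} + l₂ j`. -/
def opA {m n : ℕ} (r l₁ : Fin m → ℝ) (μ l₂ : Fin n → ℝ) : PartialOp :=
  (PartialOp.leftComp fun j : Fin n => (rlOp (μ j)).addConst (l₂ j)).comp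
    (PartialOp.leftComp fun i : Fin m => lfdo (l₁ i) (r i))

/-- The operator of the `k`-th initial condition: all the `lfdo (l₁ i) (r i)` are applied first,
then the `₀D_t^{μ j} + l₂ j` for all `j` but the first one, and then `₀D_t^{μ₁ - k}`, where `μ₁` is
the first entry of `μ`. -/
def opInit {m n : ℕ} (hn : 0 < n) (r l₁ : Fin m → ℝ) (μ l₂ : Fin n → ℝ) (k : ℕ) : PartialOp :=
  (rlOp (μ ⟨0, hn⟩ - k)).comp
    ((PartialOp.leftComp fun j : Fin (n - 1) =>
        (rlOp (μ ⟨j + 1, by omega⟩)).addConst (l₂ ⟨j + 1, by omega⟩)).comp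
      (PartialOp.leftComp fun i : Fin m => lfdo (l₁ i) (r i)))

end

/-! The density of `T` is the convolution of the densities of the summands, and each operator
removes exactly one factor, leaving a constant. Write k_s(x) = x^(s-1)/Γ(s) on (0,∞). Fractional
integration is convolution with k_s, the semigroup law k_s * k_t = k_(s+t) holds (`cconv_rlKernel`),
and so D^r sends k_r * f + c k_r to f (`Causal.rlOp_sends`).

For a gamma factor, multiplication by e^(λt) distributes over convolution and turns the density into
λ^r k_r, so the conjugated derivative strips it (`strips_lfdo`). A Mittag-Leffler density h
satisfies h + λ k_μ * h = λ k_μ (`mittagLefflerPDFReal_add_cconv`); hence D^μ(h * f) = λf - λ h * f,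
and D^μ + λ strips h (`strips_addConst`). Applied to a lone remaining factor, either operator gives
0, which is the equation.

For the initial conditions the first Mittag-Leffler factor is placed last. The other operators
reduce the density to a multiple of h, and D^(μ-k) h = λ(k_k - k_k * h), whose limit at 0 is read
off from k_1 = 1 and from primitives vanishing at 0. The factors may be reordered because continuous
densities agree on (0,∞) (`HasDensity.eqOn`). -/

/-! ### Convolution algebra of causal functions -/

/-- Functions on `ℝ` supported in `(0, ∞)`, continuous there and locally integrable. -/
structure Causal (f : ℝ → ℝ) : Prop where
  zero : ∀ x ≤ 0, f x = 0
  cont : ContinuousOn f (Ioi 0)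
  loc : LocallyIntegrable f volume

/-- The convolution of real functions with respect to Lebesgue measure. -/
noncomputable def cconv (f g : ℝ → ℝ) : ℝ → ℝ :=
  MeasureTheory.convolution f g (ContinuousLinearMap.mul ℝ ℝ) volume

theorem cconv_apply (f g : ℝ → ℝ) (x : ℝ) : cconv f g x = ∫ t, f t * g (x - t) := rfl

namespace Causal

variable {f g h : ℝ → ℝ}

theorem integrableOn_Icc (hf : Causal f) (a b : ℝ) : IntegrableOn f (Icc a b) :=
  hf.loc.integrableOn_isCompact isCompact_Icc

theorem intervalIntegrable (hf : Causal f) (a b : ℝ) : IntervalIntegrable f volume a b :=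
  (hf.loc.integrableOn_isCompact isCompact_uIcc).intervalIntegrable

theorem add (hf : Causal f) (hg : Causal g) : Causal (f + g) :=
  ⟨fun x hx => by simp [hf.zero x hx, hg.zero x hx], hf.cont.add hg.cont, hf.loc.add hg.loc⟩

theorem continuous_mul (hf : Causal f) {c : ℝ → ℝ} (hc : Continuous c) : Causal (c * f) := by
  refine ⟨fun x hx => by simp [hf.zero x hx], hc.continuousOn.mul hf.cont, ?_⟩
  exact LocallyIntegrable.continuous_mul hc hf.loc

theorem smul (hf : Causal f) (c : ℝ) : Causal (c • f) :=
  ⟨fun x hx => by simp [hf.zero x hx], hf.cont.const_smul c, hf.loc.smul c⟩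

theorem sub (hf : Causal f) (hg : Causal g) : Causal (f - g) := by
  simpa [sub_eq_add_neg] using hf.add (hg.smul (-1))

theorem zero_fun : Causal 0 :=
  ⟨fun _ _ => rfl, continuousOn_const, locallyIntegrable_zero⟩

theorem norm (hf : Causal f) : Causal fun x => ‖f x‖ :=
  ⟨fun x hx => by simp [hf.zero x hx], hf.cont.norm,
    fun x => (hf.loc x).imp fun _ hs => ⟨hs.1, hs.2.norm⟩⟩

/-- The singularities of the two factors sit at the opposite ends 0 and x. On each half of [0, x]
one factor is continuous and the other integrable. Convergence at every x makes the later
convolution identities hold pointwise, not just almost everywhere. -/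
theorem integrable_mul_sub (hf : Causal f) (hg : Causal g) (x : ℝ) :
    Integrable fun t => f t * g (x - t) := by
  rcases le_or_gt x 0 with hx | hx
  · have : (fun t => f t * g (x - t)) = fun _ => 0 := by
      funext t
      rcases le_or_gt t 0 with ht | ht
      · simp [hf.zero t ht]
      · simp [hg.zero (x - t) (by linarith)]
    rw [this]
    exact integrable_zero _ _ _
  · have hs : Function.support (fun t => f t * g (x - t)) ⊆ Icc 0 (x / 2) ∪ Icc (x / 2) x := by
      intro t ht
      rw [Icc_union_Icc_eq_Icc (by linarith) (by linarith)]
      by_contra hcon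
      apply ht
      simp only [mem_Icc, not_and_or, not_le] at hcon
      rcases hcon with h1 | h1
      · simp [hf.zero t h1.le]
      · simp [hg.zero (x - t) (by linarith)]
    rw [← integrableOn_iff_integrable_of_support_subset hs]
    refine IntegrableOn.union ?_ ?_
    · refine IntegrableOn.mul_continuousOn (hf.integrableOn_Icc _ _) ?_ isCompact_Icc
      refine hg.cont.comp (by fun_prop) ?_
      intro t ht
      simp only [mem_Icc, mem_Ioi] at ht ⊢
      linarith
    · refine IntegrableOn.continuousOn_mul (K := Icc (x / 2) x) (hf.cont.mono ?_) ?_ isCompact_Icc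
      · intro t ht
        simp only [mem_Icc, mem_Ioi] at ht ⊢
        linarith
      · have h1 := (hg.integrableOn_Icc 0 (x / 2)).integrable_indicator measurableSet_Icc
        have h2 := h1.comp_sub_left x
        refine h2.integrableOn.congr_fun ?_ measurableSet_Icc
        intro t ht
        have : x - t ∈ Icc 0 (x / 2) := by
          simp only [mem_Icc] at ht ⊢
          constructor <;> linarith
        simp only [indicator_of_mem this]

theorem convolutionExists (hf : Causal f) (hg : Causal g) :
    ConvolutionExists f g (ContinuousLinearMap.mul ℝ ℝ) volume := fun x =>
  hf.integrable_mul_sub hg x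

theorem cconv_add (hf : Causal f) (hg : Causal g) (hh : Causal h) :
    cconv f (g + h) = cconv f g + cconv f h :=
  (hf.convolutionExists hg).distrib_add (hf.convolutionExists hh)

theorem add_cconv (hf : Causal f) (hg : Causal g) (hh : Causal h) :
    cconv (f + g) h = cconv f h + cconv g h :=
  (hf.convolutionExists hh).add_distrib (hg.convolutionExists hh)

end Causal

theorem cconv_smul (f g : ℝ → ℝ) (c : ℝ) : cconv f (c • g) = c • cconv f g :=
  MeasureTheory.convolution_smul

theorem smul_cconv (f g : ℝ → ℝ) (c : ℝ) : cconv (c • f) g = c • cconv f g :=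
  MeasureTheory.smul_convolution

theorem cconv_comm (f g : ℝ → ℝ) : cconv f g = cconv g f := by
  funext x
  rw [cconv_apply, cconv_apply, ← integral_sub_left_eq_self _ volume x]
  simp [mul_comm]

/-- A continuous, compactly supported function that is `1` on `[2δ, R]` and vanishes on
`(-∞, δ]`. -/
theorem exists_cutoff {δ : ℝ} (hδ : 0 < δ) (R : ℝ) :
    ∃ χ : ℝ → ℝ, Continuous χ ∧ HasCompactSupport χ ∧ (∀ x ≤ δ, χ x = 0) ∧
      ∀ x, 2 * δ ≤ x → x ≤ R → χ x = 1 := by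
  refine ⟨fun x => max 0 (min 1 (min (x / δ - 1) (R + 1 - x))), by fun_prop, ?_, ?_, ?_⟩
  · refine HasCompactSupport.intro (isCompact_Icc (a := δ) (b := R + 1)) ?_
    intro x hx
    simp only [mem_Icc, not_and_or, not_le] at hx
    refine max_eq_left (min_le_of_right_le ?_)
    rcases hx with hx | hx
    · refine min_le_of_left_le ?_
      have := (div_lt_one hδ).2 hx
      linarith
    · exact min_le_of_right_le (by linarith)
  · intro x hx
    refine max_eq_left (min_le_of_right_le (min_le_of_left_le ?_))
    have := (div_le_one hδ).2 hx
    linarith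
  · intro x h1 h2
    have : 2 ≤ x / δ := (le_div_iff₀ hδ).2 h1
    have h3 : min 1 (min (x / δ - 1) (R + 1 - x)) = 1 :=
      min_eq_left (le_min (by linarith) (by linarith))
    simp [h3]

namespace Causal

variable {f g h : ℝ → ℝ}

theorem continuous_cutoff_mul (hf : Causal f) {χ : ℝ → ℝ} (hχ : Continuous χ) {δ : ℝ}
    (hδ : 0 < δ) (h0 : ∀ x ≤ δ, χ x = 0) : Continuous (χ * f) := by
  rw [continuous_iff_continuousAt]
  intro x
  rcases lt_or_ge x δ with hx | hx
  · have : (χ * f) =ᶠ[𝓝 x] fun _ => 0 := by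
      filter_upwards [Iio_mem_nhds hx] with y hy
      simp [h0 y (le_of_lt hy)]
    exact continuousAt_const.congr this.symm
  · exact hχ.continuousAt.mul (hf.cont.continuousAt (Ioi_mem_nhds (hδ.trans_le hx)))

theorem cconv_zero_of_nonpos (hf : Causal f) (hg : Causal g) {x : ℝ} (hx : x ≤ 0) :
    cconv f g x = 0 := by
  rw [cconv_apply]
  have : (fun t => f t * g (x - t)) = fun _ => 0 := by
    funext t
    rcases le_or_gt t 0 with ht | ht
    · simp [hf.zero t ht]
    · simp [hg.zero (x - t) (by linarith)]
  simp [this]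

/-- Cutting both factors off near 0 leaves two convolutions with a continuous, compactly supported
factor, plus one of the two remainders. The latter vanishes near t₀: if t + s > t₀/2, then t or s is
at least t₀/4, where the remainders are 0. -/
theorem continuousAt_cconv (hf : Causal f) (hg : Causal g) {t₀ : ℝ} (ht₀ : 0 < t₀) :
    ContinuousAt (cconv f g) t₀ := by
  obtain ⟨χ, hχ, hcs, h0, h1⟩ := exists_cutoff (show 0 < t₀ / 8 by linarith) (2 * t₀)
  have hδ : 0 < t₀ / 8 := by linarith
  have hf2 := hf.continuous_mul hχ
  have hg2 := hg.continuous_mul hχ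
  have hf1 := hf.sub hf2
  have hg1 := hg.sub hg2
  have e1 : cconv f g = cconv (χ * f) g + (cconv (f - χ * f) (χ * g)
      + cconv (f - χ * f) (g - χ * g)) := by
    rw [← hf1.cconv_add hg2 hg1, add_sub_cancel, ← hf2.add_cconv hf1 hg, add_sub_cancel]
  have c1 : Continuous (cconv (χ * f) g) :=
    (HasCompactSupport.mul_right hcs).continuous_convolution_left _
      (hf.continuous_cutoff_mul hχ hδ h0) hg.loc
  have c2 : Continuous (cconv (f - χ * f) (χ * g)) :=
    (HasCompactSupport.mul_right hcs).continuous_convolution_right _ hf1.loc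
      (hg.continuous_cutoff_mul hχ hδ h0)
  have vanish : ∀ (u : ℝ → ℝ) (x), t₀ / 4 ≤ x → x ≤ 2 * t₀ → (u - χ * u) x = 0 := by
    intro u x hx hx'
    simp [h1 x (by linarith) hx']
  have e2 : cconv (f - χ * f) (g - χ * g) =ᶠ[𝓝 t₀] fun _ => 0 := by
    filter_upwards [Ioo_mem_nhds (show t₀ / 2 < t₀ by linarith) (show t₀ < 2 * t₀ by linarith)]
      with x hx
    rw [cconv_apply]
    have : (fun t => (f - χ * f) t * (g - χ * g) (x - t)) = fun _ => 0 := by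
      funext t
      rcases le_or_gt t 0 with ht | ht
      · simp [hf1.zero t ht]
      rcases le_or_gt x t with hxt | hxt
      · rw [hg1.zero (x - t) (by linarith), mul_zero]
      rcases le_or_gt (t₀ / 4) t with h4 | h4
      · rw [vanish f t h4 (by linarith [hx.2]), zero_mul]
      · rw [vanish g (x - t) (by linarith [hx.1]) (by linarith [hx.2]), mul_zero]
    rw [this, integral_zero]
  rw [e1]
  exact c1.continuousAt.add (c2.continuousAt.add (continuousAt_const.congr e2.symm))

theorem conv (hf : Causal f) (hg : Causal g) : Causal (cconv f g) := by
  refine ⟨fun x hx => hf.cconv_zero_of_nonpos hg hx,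
    fun x hx => (hf.continuousAt_cconv hg hx).continuousWithinAt, ?_⟩
  intro x
  refine ⟨Iio (x + 1), Iio_mem_nhds (by linarith), ?_⟩
  -- By causality, values of the convolution below x + 1 see only the factors on [0, x + 1], so
  -- truncation reduces the claim to integrable functions.
  have trunc : ∀ {u : ℝ → ℝ}, Causal u → Integrable (indicator (Icc 0 (x + 1)) u) := fun hu =>
    (hu.integrableOn_Icc _ _).integrable_indicator measurableSet_Icc
  have := (trunc hf).integrable_convolution (ContinuousLinearMap.mul ℝ ℝ) (trunc hg)
  refine this.integrableOn.congr_fun ?_ measurableSet_Iio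
  intro y hy
  refine integral_congr_ae (Eventually.of_forall fun t => ?_)
  simp only [ContinuousLinearMap.mul_apply']
  rcases le_or_gt t 0 with ht | ht
  · rw [hf.zero t ht, indicator_apply_eq_zero.2 (fun _ => hf.zero t ht), zero_mul, zero_mul]
  rcases le_or_gt y t with hyt | hyt
  · rw [hg.zero (y - t) (by linarith),
      indicator_apply_eq_zero.2 (fun _ => hg.zero (y - t) (by linarith)), mul_zero, mul_zero]
  have hy' : y < x + 1 := hy
  rw [indicator_of_mem, indicator_of_mem] <;> constructor <;> linarith

theorem cconv_assoc (hf : Causal f) (hg : Causal g) (hh : Causal h) :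
    cconv (cconv f g) h = cconv f (cconv g h) := by
  funext x
  refine MeasureTheory.convolution_assoc (ContinuousLinearMap.mul ℝ ℝ)
    (ContinuousLinearMap.mul ℝ ℝ) (ContinuousLinearMap.mul ℝ ℝ) (ContinuousLinearMap.mul ℝ ℝ)
    (fun a b c => by simp [mul_assoc]) hf.loc.aestronglyMeasurable
    hg.loc.aestronglyMeasurable hh.loc.aestronglyMeasurable
    (Eventually.of_forall (hf.convolutionExists hg))
    (Eventually.of_forall (hg.norm.convolutionExists hh.norm)) ?_
  exact hf.norm.convolutionExists (hg.norm.conv hh.norm) x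

end Causal

/-! ### Power kernels and fractional integrals -/

/-- The kernel `x ^ (s - 1) / Γ(s)` of the fractional integral of order `s`. -/
noncomputable def rlKernel (s x : ℝ) : ℝ :=
  if 0 < x then x ^ (s - 1) / Real.Gamma s else 0

theorem rlKernel_of_pos (s : ℝ) {x : ℝ} (hx : 0 < x) :
    rlKernel s x = x ^ (s - 1) / Real.Gamma s := if_pos hx

theorem rlKernel_of_nonpos (s : ℝ) {x : ℝ} (hx : x ≤ 0) : rlKernel s x = 0 :=
  if_neg (not_lt.2 hx)

theorem rlKernel_one {x : ℝ} (hx : 0 < x) : rlKernel 1 x = 1 := by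
  simp [rlKernel_of_pos 1 hx]

theorem rlKernel_nonneg {s : ℝ} (hs : 0 < s) (x : ℝ) : 0 ≤ rlKernel s x := by
  unfold rlKernel
  split_ifs with h
  · have := Real.Gamma_pos_of_pos hs
    positivity
  · exact le_rfl

theorem causal_rlKernel {s : ℝ} (hs : 0 < s) : Causal (rlKernel s) := by
  refine ⟨fun x hx => rlKernel_of_nonpos s hx, ?_, ?_⟩
  · refine ContinuousOn.congr (f := fun x => x ^ (s - 1) / Real.Gamma s) ?_
      fun x hx => rlKernel_of_pos s hx
    exact (continuousOn_id.rpow_const fun x hx => Or.inl (ne_of_gt hx)).div_const _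
  · intro x
    refine ⟨Iio (|x| + 1), Iio_mem_nhds (by linarith [le_abs_self x]), ?_⟩
    have h1 := (intervalIntegral.intervalIntegrable_rpow' (a := 0) (b := |x| + 1)
      (show -1 < s - 1 by linarith)).div_const (Real.Gamma s)
    rw [intervalIntegrable_iff_integrableOn_Ioc_of_le (by positivity)] at h1
    have h2 := h1.integrable_indicator measurableSet_Ioc
    refine h2.integrableOn.congr_fun ?_ measurableSet_Iio
    intro y hy
    rcases le_or_gt y 0 with h | h
    · rw [rlKernel_of_nonpos s h, indicator_of_notMem]
      exact fun hh => absurd hh.1 (not_lt.2 h)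
    · rw [rlKernel_of_pos s h, indicator_of_mem (show y ∈ Ioc 0 (|x| + 1) from ⟨h, le_of_lt hy⟩)]

/-- The convolution of causal functions as an integral over `(0, x)`. -/
theorem Causal.cconv_eq_intervalIntegral {f g : ℝ → ℝ} (hf : Causal f) (hg : Causal g) {x : ℝ}
    (hx : 0 ≤ x) : cconv f g x = ∫ y in (0 : ℝ)..x, f (x - y) * g y := by
  rw [cconv_comm, cconv_apply, intervalIntegral.integral_of_le hx,
    ← integral_indicator measurableSet_Ioc]
  congr 1
  funext y
  by_cases hy : y ∈ Ioc 0 x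
  · rw [indicator_of_mem hy, mul_comm]
  · rw [indicator_of_notMem hy]
    rw [mem_Ioc, not_and_or, not_lt, not_le] at hy
    rcases hy with hy | hy
    · rw [hg.zero y hy, zero_mul]
    · rw [hf.zero (x - y) (by linarith), mul_zero]

theorem integral_rpow_mul_sub_rpow {s t x : ℝ} (hs : 0 < s) (ht : 0 < t) (hx : 0 < x) :
    ∫ y in (0 : ℝ)..x, (x - y) ^ (t - 1) * y ^ (s - 1) =
      x ^ (s + t - 1) * (Real.Gamma s * Real.Gamma t / Real.Gamma (s + t)) := by
  have h1 := Complex.betaIntegral_scaled s t hx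
  have h2 := Complex.Gamma_mul_Gamma_eq_betaIntegral (s := s) (t := t) (by simpa) (by simpa)
  have hst : Complex.Gamma ((s : ℂ) + t) ≠ 0 :=
    Complex.Gamma_ne_zero_of_re_pos (by simp; linarith)
  have h3 : Complex.betaIntegral s t
      = Complex.Gamma s * Complex.Gamma t / Complex.Gamma ((s : ℂ) + t) := by
    rw [h2, mul_div_cancel_left₀ _ hst]
  rw [h3] at h1
  apply Complex.ofReal_injective
  rw [← intervalIntegral.integral_ofReal]
  have h4 : ∫ y in (0 : ℝ)..x, (((x - y) ^ (t - 1) * y ^ (s - 1) : ℝ) : ℂ) =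
      ∫ y in (0 : ℝ)..x, (y : ℂ) ^ ((s : ℂ) - 1) * ((x : ℂ) - y) ^ ((t : ℂ) - 1) := by
    refine intervalIntegral.integral_congr fun y hy => ?_
    rw [uIcc_of_le hx.le] at hy
    rw [mul_comm, Complex.ofReal_mul, Complex.ofReal_cpow hy.1,
      Complex.ofReal_cpow (by linarith [hy.2])]
    push_cast
    rfl
  rw [h4, h1]
  rw [Complex.ofReal_mul, Complex.ofReal_cpow hx.le, Complex.ofReal_div, Complex.ofReal_mul,
    ← Complex.Gamma_ofReal, ← Complex.Gamma_ofReal, ← Complex.Gamma_ofReal]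
  push_cast
  rfl

/-- This is Euler's beta integral; the Gamma normalisation absorbs the beta constant. -/
theorem cconv_rlKernel {s t : ℝ} (hs : 0 < s) (ht : 0 < t) :
    cconv (rlKernel s) (rlKernel t) = rlKernel (s + t) := by
  funext x
  rcases le_or_gt x 0 with hx | hx
  · rw [(causal_rlKernel hs).cconv_zero_of_nonpos (causal_rlKernel ht) hx,
      rlKernel_of_nonpos _ hx]
  · have h1 := Real.Gamma_pos_of_pos hs
    have h2 := Real.Gamma_pos_of_pos ht
    rw [(causal_rlKernel hs).cconv_eq_intervalIntegral (causal_rlKernel ht) hx.le,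
      rlKernel_of_pos _ hx]
    have e : ∫ y in (0 : ℝ)..x, rlKernel s (x - y) * rlKernel t y =
        ∫ y in (0 : ℝ)..x,
          ((x - y) ^ (s - 1) * y ^ (t - 1)) * (1 / (Real.Gamma s * Real.Gamma t)) := by
      rw [intervalIntegral.integral_of_le hx.le, intervalIntegral.integral_of_le hx.le,
        integral_Ioc_eq_integral_Ioo, integral_Ioc_eq_integral_Ioo]
      refine setIntegral_congr_fun measurableSet_Ioo fun y hy => ?_
      rw [rlKernel_of_pos _ hy.1, rlKernel_of_pos _ (sub_pos.2 hy.2)]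
      field_simp
    rw [e, intervalIntegral.integral_mul_const, integral_rpow_mul_sub_rpow ht hs hx, add_comm t s]
    field_simp

theorem Causal.rlKernel_cconv_cconv {f : ℝ → ℝ} (hf : Causal f) {s t : ℝ} (hs : 0 < s)
    (ht : 0 < t) : cconv (rlKernel s) (cconv (rlKernel t) f) = cconv (rlKernel (s + t)) f := by
  rw [← (causal_rlKernel hs).cconv_assoc (causal_rlKernel ht) hf, cconv_rlKernel hs ht]

theorem Causal.rlKernel_one_cconv {f : ℝ → ℝ} (hf : Causal f) {x : ℝ} (hx : 0 ≤ x) :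
    cconv (rlKernel 1) f x = ∫ y in (0 : ℝ)..x, f y := by
  rw [(causal_rlKernel one_pos).cconv_eq_intervalIntegral hf hx,
    intervalIntegral.integral_of_le hx, intervalIntegral.integral_of_le hx,
    integral_Ioc_eq_integral_Ioo, integral_Ioc_eq_integral_Ioo]
  refine setIntegral_congr_fun measurableSet_Ioo fun y hy => ?_
  rw [rlKernel_one (sub_pos.2 hy.2), one_mul]

theorem Causal.hasDerivAt_rlKernel_one_cconv {f : ℝ → ℝ} (hf : Causal f) {x : ℝ} (hx : 0 < x) :
    HasDerivAt (cconv (rlKernel 1) f) (f x) x := by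
  have h1 : HasDerivAt (fun u => ∫ y in (0 : ℝ)..u, f y) (f x) x := by
    refine intervalIntegral.integral_hasDerivAt_right ?_ ?_
      (hf.cont.continuousAt (Ioi_mem_nhds hx))
    · exact hf.intervalIntegrable _ _
    · exact hf.loc.aestronglyMeasurable.stronglyMeasurableAtFilter
  refine h1.congr_of_eventuallyEq ?_
  filter_upwards [Ioi_mem_nhds hx] with y hy
  exact hf.rlKernel_one_cconv (le_of_lt hy)

theorem Causal.tendsto_rlKernel_one_cconv {f : ℝ → ℝ} (hf : Causal f) :
    Tendsto (cconv (rlKernel 1) f) (𝓝[>] 0) (𝓝 0) := by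
  have h1 : Continuous fun u => ∫ y in (0 : ℝ)..u, f y :=
    intervalIntegral.continuous_primitive (fun _ _ => hf.intervalIntegrable _ _) 0
  have h2 : Tendsto (fun u => ∫ y in (0 : ℝ)..u, f y) (𝓝[>] 0) (𝓝 0) := by
    have := (h1.tendsto 0).mono_left (nhdsWithin_le_nhds (s := Ioi 0))
    simpa using this
  refine h2.congr' ?_
  filter_upwards [self_mem_nhdsWithin] with y hy
  exact (hf.rlKernel_one_cconv (le_of_lt hy)).symm

/-- The `N`-fold integral of a causal function is `N` times differentiable on `(0, ∞)`. -/
theorem Causal.contDiffOn_rlKernel_nat_cconv {f : ℝ → ℝ} (hf : Causal f) (N : ℕ) {g : ℝ → ℝ}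
    (hg : EqOn g (cconv (rlKernel (N + 1 : ℕ)) f) (Ioi 0)) :
    ContDiffOn ℝ (N + 1 : ℕ) g (Ioi 0) ∧ EqOn (iteratedDeriv (N + 1) g) f (Ioi 0) := by
  induction N generalizing g with
  | zero =>
    have hd : ∀ x ∈ Ioi (0 : ℝ), HasDerivAt g (f x) x := fun x hx =>
      (hf.hasDerivAt_rlKernel_one_cconv hx).congr_of_eventuallyEq <| by
        filter_upwards [Ioi_mem_nhds hx] with y hy
        simpa using hg hy
    have hd' : EqOn (deriv g) f (Ioi 0) := fun x hx => (hd x hx).deriv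
    refine ⟨?_, by simpa [iteratedDeriv_one] using hd'⟩
    rw [Nat.cast_add_one, contDiffOn_succ_iff_deriv_of_isOpen isOpen_Ioi]
    refine ⟨fun x hx => (hd x hx).differentiableAt.differentiableWithinAt, by simp, ?_⟩
    rw [Nat.cast_zero, contDiffOn_zero]
    exact hf.cont.congr hd'
  | succ N ih =>
    have e : cconv (rlKernel (N + 1 + 1 : ℕ)) f =
        cconv (rlKernel 1) (cconv (rlKernel (N + 1 : ℕ)) f) := by
      rw [hf.rlKernel_cconv_cconv one_pos (by positivity), Nat.cast_add_one (N + 1), add_comm]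
    have hc := (causal_rlKernel (s := (N + 1 : ℕ)) (by positivity)).conv hf
    have hd : ∀ x ∈ Ioi (0 : ℝ), HasDerivAt g (cconv (rlKernel (N + 1 : ℕ)) f x) x := fun x hx =>
      (hc.hasDerivAt_rlKernel_one_cconv hx).congr_of_eventuallyEq <| by
        filter_upwards [Ioi_mem_nhds hx] with y hy
        rw [hg hy, e]
    obtain ⟨h1, h2⟩ := ih (g := deriv g) fun x hx => (hd x hx).deriv
    refine ⟨?_, by rwa [iteratedDeriv_succ']⟩
    rw [Nat.cast_add_one, contDiffOn_succ_iff_deriv_of_isOpen isOpen_Ioi]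
    exact ⟨fun x hx => (hd x hx).differentiableAt.differentiableWithinAt, by simp, h1⟩

/-- On (0,∞) this kernel is a monomial of degree N, killed by N + 1 derivatives. This is why D^r
annihilates k_r. -/
theorem contDiffOn_rlKernel_nat (N : ℕ) :
    ContDiffOn ℝ (N + 1 : ℕ) (rlKernel (N + 1 : ℕ)) (Ioi 0) ∧
      EqOn (iteratedDeriv (N + 1) (rlKernel (N + 1 : ℕ))) 0 (Ioi 0) := by
  have e : EqOn (rlKernel (N + 1 : ℕ)) (fun x => x ^ N / Real.Gamma (N + 1 : ℕ)) (Ioi 0) := by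
    intro x hx
    rw [rlKernel_of_pos _ hx]
    simp
  refine ⟨ContDiffOn.congr (by fun_prop) e, fun x hx => ?_⟩
  rw [Filter.EventuallyEq.iteratedDeriv_eq (N + 1)
    (Filter.eventuallyEq_of_mem (Ioi_mem_nhds hx) e)]
  rw [iteratedDeriv_div_const, iteratedDeriv_pow]
  simp

theorem rlInt_eqOn_cconv {s : ℝ} (hs : 0 < s) {f f' : ℝ → ℝ} (hf : Causal f)
    (hf' : EqOn f' f (Ioi 0)) : EqOn (rlInt s f') (cconv (rlKernel s) f) (Ioi 0) := by
  intro x hx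
  have hx' : (0 : ℝ) < x := hx
  rw [(causal_rlKernel hs).cconv_eq_intervalIntegral hf hx'.le, rlInt,
    ← intervalIntegral.integral_const_mul, intervalIntegral.integral_of_le hx'.le,
    intervalIntegral.integral_of_le hx'.le, integral_Ioc_eq_integral_Ioo,
    integral_Ioc_eq_integral_Ioo]
  refine setIntegral_congr_fun measurableSet_Ioo fun y hy => ?_
  rw [rlKernel_of_pos _ (sub_pos.2 hy.2), hf' hy.1]
  ring

theorem Causal.rlIntegrable {s : ℝ} (hs : 0 < s) {f f' : ℝ → ℝ} (hf : Causal f)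
    (hf' : EqOn f' f (Ioi 0)) : RLIntegrable s f' := by
  constructor
  · have : f' =ᵐ[volume.restrict (Ici 0)] f := by
      rw [← restrict_Ioi_eq_restrict_Ici]
      exact (ae_restrict_mem measurableSet_Ioi).mono fun x hx => hf' hx
    intro x hx
    obtain ⟨u, hu, hi⟩ := hf.loc x
    refine ⟨u ∩ Ici 0, inter_mem (mem_nhdsWithin_of_mem_nhds hu) self_mem_nhdsWithin, ?_⟩
    refine (hi.mono_set inter_subset_left).congr ?_
    exact (this.filter_mono (ae_mono (Measure.restrict_mono inter_subset_right le_rfl))).symm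
  · intro t ht
    have h1 := ((causal_rlKernel hs).integrable_mul_sub hf t).comp_sub_left t
    rw [intervalIntegrable_iff_integrableOn_Ioo_of_le ht.le]
    refine (h1.const_mul (Real.Gamma s)).integrableOn.congr_fun ?_ measurableSet_Ioo
    intro y hy
    have := (Real.Gamma_pos_of_pos hs).ne'
    simp only [sub_sub_cancel]
    rw [rlKernel_of_pos _ (sub_pos.2 hy.2), hf' hy.1]
    field_simp

/-! ### Operators acting on functions up to equality on (0,∞) -/

namespace PartialOp

/-- On `(0, ∞)`, every function that agrees with `f` is in the domain of `L` and mapped to `g`. -/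
def Sends (L : PartialOp) (f g : ℝ → ℝ) : Prop :=
  ∀ f', EqOn f' f (Ioi 0) → f' ∈ L.dom ∧ EqOn (L.act f') g (Ioi 0)

theorem Sends.congr {L : PartialOp} {f g f₁ g₁ : ℝ → ℝ} (h : L.Sends f g)
    (hf : EqOn f₁ f (Ioi 0)) (hg : EqOn g g₁ (Ioi 0)) : L.Sends f₁ g₁ := fun f' hf' =>
  ⟨(h f' (hf'.trans hf)).1, (h f' (hf'.trans hf)).2.trans hg⟩

theorem Sends.comp {L M : PartialOp} {f g h : ℝ → ℝ} (hM : M.Sends f g) (hL : L.Sends g h) :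
    (L.comp M).Sends f h := fun f' hf' =>
  ⟨⟨(hM f' hf').1, (hL _ (hM f' hf').2).1⟩, (hL _ (hM f' hf').2).2⟩

theorem sends_id (f : ℝ → ℝ) : PartialOp.id.Sends f f := fun _ hf' => ⟨mem_univ _, hf'⟩

theorem Sends.addConst {L : PartialOp} {f g : ℝ → ℝ} (h : L.Sends f g) (c : ℝ) :
    (L.addConst c).Sends f (g + c • f) := fun f' hf' =>
  ⟨(h f' hf').1, fun t ht => by
    simp [PartialOp.addConst, (h f' hf').2 ht, hf' ht]⟩

theorem Sends.conjExp {L : PartialOp} {f g : ℝ → ℝ} (α : ℝ)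
    (h : L.Sends (fun t => Real.exp (α * t) * f t) g) :
    (L.conjExp α).Sends f (fun t => Real.exp (-α * t) * g t) := by
  intro f' hf'
  have := h (fun t => Real.exp (α * t) * f' t) fun t ht => by simp only [hf' ht]
  exact ⟨this.1, fun t ht => by simp [PartialOp.conjExp, this.2 ht]⟩

end PartialOp

open PartialOp

/-- The fractional derivative inverts the fractional integral of the same order, and annihilates
its kernel. -/
theorem Causal.rlOp_sends {f : ℝ → ℝ} (hf : Causal f) {r : ℝ} (hr : 0 < r) (c : ℝ) :
    (rlOp r).Sends (cconv (rlKernel r) f + c • rlKernel r) f := by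
  intro f' hf'
  rw [rlOp, if_pos hr]
  have hk := causal_rlKernel hr
  have hs : 0 < ((⌊r⌋₊ + 1 : ℕ) : ℝ) - r := by
    have := Nat.lt_floor_add_one r
    push_cast
    linarith
  have hc := (hk.conv hf).add (hk.smul c)
  -- By the semigroup law the orders N - r and r add up to the integer N, so only classical
  -- derivatives of an N-fold integral remain.
  have e : cconv (rlKernel ((⌊r⌋₊ + 1 : ℕ) - r)) (cconv (rlKernel r) f + c • rlKernel r) =
      cconv (rlKernel (⌊r⌋₊ + 1 : ℕ)) f + c • rlKernel (⌊r⌋₊ + 1 : ℕ) := by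
    rw [(causal_rlKernel hs).cconv_add (hk.conv hf) (hk.smul c), hf.rlKernel_cconv_cconv hs hr,
      cconv_smul, cconv_rlKernel hs hr, sub_add_cancel]
  have h0 := rlInt_eqOn_cconv hs hc hf'
  rw [e] at h0
  obtain ⟨h1, h2⟩ := hf.contDiffOn_rlKernel_nat_cconv ⌊r⌋₊ (fun _ _ => rfl)
  obtain ⟨h3, h4⟩ := contDiffOn_rlKernel_nat ⌊r⌋₊
  refine ⟨⟨hc.rlIntegrable hs hf', (h1.add (contDiffOn_const.smul h3)).congr h0⟩, ?_⟩
  intro t ht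
  have ht' := Ioi_mem_nhds (mem_Ioi.1 ht)
  have h5 : ContDiffAt ℝ (⌊r⌋₊ + 1 : ℕ) (c • rlKernel (⌊r⌋₊ + 1 : ℕ)) t :=
    contDiffAt_const.smul (h3.contDiffAt ht')
  change iteratedDeriv (⌊r⌋₊ + 1) (rlInt ((⌊r⌋₊ + 1 : ℕ) - r) f') t = f t
  rw [Filter.EventuallyEq.iteratedDeriv_eq _ (Filter.eventuallyEq_of_mem ht' h0),
    iteratedDeriv_add (h1.contDiffAt ht') h5,
    h2 ht, iteratedDeriv_const_smul_field, h4 ht]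
  simp

theorem Causal.exp_mul {f : ℝ → ℝ} (hf : Causal f) (α : ℝ) :
    Causal fun t => Real.exp (α * t) * f t :=
  hf.continuous_mul (c := fun t => Real.exp (α * t)) (by fun_prop)

/-- The exponential is a character: e^(αt) = e^(αs) e^(α(t-s)) under the integral. -/
theorem exp_mul_cconv (f g : ℝ → ℝ) (α : ℝ) :
    (fun t => Real.exp (α * t) * cconv f g t) =
      cconv (fun t => Real.exp (α * t) * f t) (fun t => Real.exp (α * t) * g t) := by
  funext t
  rw [cconv_apply, cconv_apply, ← integral_const_mul]
  congr 1
  funext s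
  have : Real.exp (α * t) = Real.exp (α * s) * Real.exp (α * (t - s)) := by
    rw [← Real.exp_add]
    congr 1
    ring
  rw [this]
  ring

/-! ### Stripping factors from convolutions -/

/-- The gamma density, normalised to vanish at the origin. -/
noncomputable def gammaDensity (r l x : ℝ) : ℝ := l ^ r * Real.exp (-l * x) * rlKernel r x

theorem causal_gammaDensity {r : ℝ} (hr : 0 < r) (l : ℝ) : Causal (gammaDensity r l) := by
  have := (causal_rlKernel hr).continuous_mul (c := fun x => l ^ r * Real.exp (-l * x))
    (by fun_prop)
  exact this

theorem gammaDensity_ae_eq (r l : ℝ) : gammaPDFReal r l =ᵐ[volume] gammaDensity r l := by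
  filter_upwards [Measure.ae_ne volume (0 : ℝ)] with x hx
  rcases lt_or_gt_of_ne hx with h | h
  · rw [gammaPDFReal, if_neg (not_le.2 h), gammaDensity, rlKernel_of_nonpos _ h.le, mul_zero]
  · rw [gammaPDFReal, if_pos h.le, gammaDensity, rlKernel_of_pos _ h, neg_mul]
    ring

theorem exp_mul_gammaDensity (r l : ℝ) :
    (fun t => Real.exp (l * t) * gammaDensity r l t) = l ^ r • rlKernel r := by
  funext t
  have : Real.exp (l * t) * Real.exp (-l * t) = 1 := by
    rw [← Real.exp_add]
    simp
  simp only [gammaDensity, Pi.smul_apply, smul_eq_mul]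
  linear_combination (l ^ r * rlKernel r t) * this

/-- Convolution of a finite sequence of functions; the empty sequence gives `0`. -/
noncomputable def cconvList : List (ℝ → ℝ) → ℝ → ℝ
  | [] => 0
  | [f] => f
  | f :: g :: l => cconv f (cconvList (g :: l))

theorem causal_cconvList : ∀ {l : List (ℝ → ℝ)}, (∀ f ∈ l, Causal f) → Causal (cconvList l)
  | [], _ => Causal.zero_fun
  | [f], h => h f (by simp)
  | f :: g :: l, h => (h f (by simp)).conv (causal_cconvList fun u hu => h u (by
      simp only [List.mem_cons] at hu ⊢
      tauto))

/-- An operator that strips off the first factor `d` of convolutions, leaving the constant `c`. -/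
def Strips (L : PartialOp) (d : ℝ → ℝ) (c : ℝ) : Prop :=
  ∀ l : List (ℝ → ℝ), (∀ f ∈ l, Causal f) → ∀ a : ℝ,
    L.Sends (a • cconvList (d :: l)) ((a * c) • cconvList l)

/-- The lone factor needs its own case: the convolution unit is not a function, and the empty list
stands for 0. -/
theorem strips_of_sends {L : PartialOp} {d : ℝ → ℝ} {c : ℝ}
    (h0 : ∀ a : ℝ, L.Sends (a • d) 0)
    (h1 : ∀ (a : ℝ) (f : ℝ → ℝ), Causal f → L.Sends (a • cconv d f) ((a * c) • f)) :
    Strips L d c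
  | [], _, a => by simpa [cconvList] using h0 a
  | f :: l, hl, a => h1 a _ (causal_cconvList hl)

theorem strips_lfdo {r : ℝ} (hr : 0 < r) (l : ℝ) :
    Strips (lfdo l r) (gammaDensity r l) (l ^ r) := by
  refine strips_of_sends (fun a => ?_) fun a f hf => ?_
  · have h := Causal.zero_fun.rlOp_sends hr (a * l ^ r)
    refine (Sends.conjExp l (h.congr (fun t _ => ?_) fun _ _ => rfl)).congr (fun _ _ => rfl)
      fun t _ => by simp
    have e := congrFun (exp_mul_gammaDensity r l) t
    have z : cconv (rlKernel r) 0 = 0 := MeasureTheory.convolution_zero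
    simp only [Pi.smul_apply, smul_eq_mul, Pi.add_apply, z, Pi.zero_apply] at e ⊢
    linear_combination a * e
  · have h := ((hf.exp_mul l).smul (a * l ^ r)).rlOp_sends hr 0
    refine (Sends.conjExp l (h.congr (fun t _ => ?_) fun _ _ => rfl)).congr (fun _ _ => rfl)
      fun t _ => ?_
    · have e := congrFun (exp_mul_cconv (gammaDensity r l) f l) t
      rw [exp_mul_gammaDensity, smul_cconv] at e
      rw [cconv_smul]
      simp only [Pi.smul_apply, smul_eq_mul, Pi.add_apply] at e ⊢
      linear_combination a * e
    · have : Real.exp (l * t) * Real.exp (-l * t) = 1 := by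
        rw [← Real.exp_add]
        simp
      simp only [Pi.smul_apply, smul_eq_mul]
      linear_combination (a * l ^ r * f t) * this

/-- A causal function `h` solving `h + l I^μ h = l x^{μ-1}/Γ(μ)` is stripped by `D^μ + l`. -/
theorem strips_addConst {h : ℝ → ℝ} (hh : Causal h) {μ l : ℝ} (hμ : 0 < μ)
    (e : h + l • cconv (rlKernel μ) h = l • rlKernel μ) :
    Strips ((rlOp μ).addConst l) h l := by
  have hk := causal_rlKernel hμ
  refine strips_of_sends (fun a => ?_) fun a f hf => ?_
  -- The equation for h writes a h as k_μ * (-a l h) + a l k_μ, so D^μ returns -a l h, which the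
  -- added constant l cancels.
  · have h1 := ((hh.smul (-(a * l))).rlOp_sends hμ (a * l))
    refine ((h1.congr (f₁ := a • h) (fun t _ => ?_) fun _ _ => rfl).addConst l).congr
      (fun _ _ => rfl) fun t _ => ?_
    · have e' := congrFun e t
      rw [cconv_smul]
      simp only [Pi.smul_apply, smul_eq_mul, Pi.add_apply] at e' ⊢
      linear_combination a * e'
    · simp only [Pi.smul_apply, smul_eq_mul, Pi.add_apply, Pi.zero_apply]
      ring
  -- Convolving the equation with f gives a h * f = k_μ * (a l f - a l h * f); the second term
  -- cancels against the added constant.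
  · have h1 := (((hf.smul (a * l)).sub ((hh.conv hf).smul (a * l))).rlOp_sends hμ 0)
    refine ((h1.congr (f₁ := a • cconv h f) (fun t _ => ?_) fun _ _ => rfl).addConst l).congr
      (fun _ _ => rfl) fun t _ => ?_
    · have e' := congrFun (congrArg (fun u => cconv u f) e) t
      rw [hh.add_cconv ((hk.conv hh).smul l) hf, smul_cconv, smul_cconv,
        hk.cconv_assoc hh hf] at e'
      have e2 : cconv (rlKernel μ) ((a * l) • f - (a * l) • cconv h f) =
          (a * l) • cconv (rlKernel μ) f - (a * l) • cconv (rlKernel μ) (cconv h f) := by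
        rw [sub_eq_add_neg, ← neg_smul, hk.cconv_add (hf.smul _) ((hh.conv hf).smul _),
          cconv_smul, cconv_smul, neg_smul, sub_eq_add_neg]
      rw [e2]
      simp only [Pi.smul_apply, smul_eq_mul, Pi.add_apply, Pi.sub_apply] at e' ⊢
      linear_combination a * e'
    · simp only [Pi.smul_apply, smul_eq_mul, Pi.add_apply, Pi.sub_apply]
      ring

/-- The tail is arbitrary so that in the induction the factor of the last operator can join it while
the earlier operators act. -/
theorem sends_leftComp {k : ℕ} (L : Fin k → PartialOp) (d : Fin k → ℝ → ℝ) (c : Fin k → ℝ)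
    (hd : ∀ i, Causal (d i)) (hL : ∀ i, Strips (L i) (d i) (c i)) (l : List (ℝ → ℝ))
    (hl : ∀ f ∈ l, Causal f) (a : ℝ) :
    (leftComp L).Sends (a • cconvList (List.ofFn d ++ l)) ((a * ∏ i, c i) • cconvList l) := by
  induction k generalizing l with
  | zero => simpa [leftComp] using sends_id (a • cconvList l)
  | succ k ih =>
    have h1 := ih (fun i => L i.castSucc) (fun i => d i.castSucc) (fun i => c i.castSucc)
      (fun i => hd _) (fun i => hL _) (d (Fin.last k) :: l) (by
        intro f hf
        rcases List.mem_cons.1 hf with rfl | hf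
        exacts [hd _, hl f hf])
    have h2 := hL (Fin.last k) l hl (a * ∏ i : Fin k, c i.castSucc)
    have h3 := h1.comp h2
    rw [List.ofFn_succ', List.concat_eq_append, List.append_assoc, Fin.prod_univ_castSucc,
      ← mul_assoc]
    exact h3

/-! ### The Mittag-Leffler density and its integral equation -/

/-- Restrict the Gamma integral to (R,∞), where x^(s-1) ≥ R^(s-1). As R is free, Γ outgrows every
geometric sequence. -/
theorem rpow_mul_exp_neg_le_Gamma {R s : ℝ} (hR : 0 < R) (hs : 1 ≤ s) :
    R ^ (s - 1) * Real.exp (-R) ≤ Real.Gamma s := by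
  have hi := Real.GammaIntegral_convergent (s := s) (by linarith)
  have hsub : Ioi R ⊆ Ioi 0 := Ioi_subset_Ioi hR.le
  have he : IntegrableOn (fun x : ℝ => Real.exp (-x)) (Ioi R) := integrableOn_exp_neg_Ioi R
  rw [Real.Gamma_eq_integral (by linarith), ← integral_exp_neg_Ioi R, ← integral_const_mul]
  calc ∫ x in Ioi R, R ^ (s - 1) * Real.exp (-x)
      ≤ ∫ x in Ioi R, Real.exp (-x) * x ^ (s - 1) := by
        refine setIntegral_mono_on (he.const_mul _) (hi.mono_set hsub) measurableSet_Ioi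
          fun x hx => ?_
        rw [mul_comm]
        have : R ≤ x := le_of_lt hx
        gcongr
    _ ≤ ∫ x in Ioi 0, Real.exp (-x) * x ^ (s - 1) := by
        refine setIntegral_mono_set hi ?_ (Eventually.of_forall hsub)
        filter_upwards [ae_restrict_mem measurableSet_Ioi] with x hx
        have : (0 : ℝ) < x := hx
        positivity

theorem summable_pow_div_Gamma {α β : ℝ} (hα : 0 < α) (z : ℝ) :
    Summable fun k : ℕ => z ^ k / Real.Gamma (α * k + β) := by
  -- With R^α = w, the Gamma bound dominates the terms by a constant times (|z|/w)^k ≤ 2^(-k); the 1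
  -- keeps w positive at z = 0.
  set w : ℝ := 2 * |z| + 1
  have hw : 0 < w := by positivity
  set R : ℝ := w ^ α⁻¹
  have hR : 0 < R := Real.rpow_pos_of_pos hw _
  have hRw : R ^ α = w := Real.rpow_inv_rpow hw.le hα.ne'
  set C : ℝ := R ^ (1 - β) * Real.exp R
  refine Summable.of_norm_bounded_eventually_nat (g := fun k : ℕ => C * (1 / 2) ^ k)
    (summable_geometric_two.mul_left C) ?_
  have ht : Tendsto (fun k : ℕ => α * (k : ℝ) + β) atTop atTop :=
    tendsto_atTop_add_const_right _ _ (tendsto_natCast_atTop_atTop.const_mul_atTop hα)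
  filter_upwards [ht.eventually_ge_atTop 1] with k hk
  have hG := rpow_mul_exp_neg_le_Gamma hR hk
  have hGpos : 0 < Real.Gamma (α * k + β) := Real.Gamma_pos_of_pos (by linarith)
  have e1 : R ^ (α * k + β - 1) = w ^ k * (R ^ (1 - β))⁻¹ := by
    rw [← hRw, ← Real.rpow_natCast, ← Real.rpow_mul hR.le, ← Real.rpow_neg hR.le,
      ← Real.rpow_add hR]
    congr 1
    ring
  have hRb : 0 < R ^ (1 - β) := Real.rpow_pos_of_pos hR _
  rw [e1, Real.exp_neg] at hG
  rw [norm_div, norm_pow, Real.norm_eq_abs, Real.norm_of_nonneg hGpos.le, div_le_iff₀ hGpos]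
  calc |z| ^ k ≤ (1 / 2) ^ k * w ^ k := by
        rw [← mul_pow]
        gcongr
        simp only [w]
        linarith
    _ = C * (1 / 2) ^ k * (w ^ k * (R ^ (1 - β))⁻¹ * (Real.exp R)⁻¹) := by
        have := Real.exp_pos R
        simp only [C]
        field_simp
    _ ≤ _ := by gcongr

theorem continuous_mittagLeffler {α β : ℝ} (hα : 0 < α) (hβ : 0 < β) :
    Continuous (mittagLeffler α β) := by
  rw [continuous_iff_continuousAt]
  intro x
  have h : ContinuousOn (mittagLeffler α β) (Ioo (-(|x| + 1)) (|x| + 1)) := by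
    refine continuousOn_tsum (fun k => by fun_prop)
      (summable_pow_div_Gamma (β := β) hα (|x| + 1)) ?_
    intro k y hy
    have hG : 0 < Real.Gamma (α * k + β) := Real.Gamma_pos_of_pos (by positivity)
    rw [norm_div, norm_pow, Real.norm_eq_abs, Real.norm_of_nonneg hG.le]
    gcongr
    exact (abs_lt.2 hy).le
  exact h.continuousAt (Ioo_mem_nhds (by linarith [neg_abs_le x]) (by linarith [le_abs_self x]))

theorem causal_mittagLefflerPDFReal {μ : ℝ} (hμ : 0 < μ) (l : ℝ) :
    Causal (mittagLefflerPDFReal μ l) := by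
  have hc : Continuous fun x : ℝ => l * Real.Gamma μ * mittagLeffler μ μ (-l * x ^ μ) := by
    have h1 : Continuous fun x : ℝ => x ^ μ := Real.continuous_rpow_const hμ.le
    have h2 := continuous_mittagLeffler hμ hμ
    fun_prop
  have h := (causal_rlKernel hμ).continuous_mul hc
  convert h using 1
  funext x
  have := (Real.Gamma_pos_of_pos hμ).ne'
  simp only [mittagLefflerPDFReal, rlKernel, Pi.mul_apply]
  split_ifs
  · field_simp
  · simp

theorem hasSum_rlKernel {μ : ℝ} (hμ : 0 < μ) (l x : ℝ) :
    HasSum (fun k : ℕ => l * (-l) ^ k * rlKernel (μ * (k + 1)) x)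
      (mittagLefflerPDFReal μ l x) := by
  rcases le_or_gt x 0 with hx | hx
  · simp only [rlKernel_of_nonpos _ hx, mul_zero, mittagLefflerPDFReal, if_neg (not_lt.2 hx)]
    exact hasSum_zero
  · rw [mittagLefflerPDFReal, if_pos hx]
    refine ((summable_pow_div_Gamma (β := μ) hμ (-l * x ^ μ)).hasSum.mul_left
      (l * x ^ (μ - 1))).congr_fun fun k => ?_
    have e : x ^ (μ * ((k : ℝ) + 1) - 1) = x ^ (μ - 1) * (x ^ μ) ^ k := by
      rw [← Real.rpow_natCast, ← Real.rpow_mul hx.le, ← Real.rpow_add hx]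
      congr 1
      ring
    rw [rlKernel_of_pos _ hx, e, mul_pow, mul_add, mul_one]
    ring

/-- The Mittag-Leffler density `h` solves `h + l I^μ h = l x^{μ-1}/Γ(μ)`. -/
theorem mittagLefflerPDFReal_add_cconv {μ : ℝ} (hμ : 0 < μ) (l : ℝ) :
    mittagLefflerPDFReal μ l + l • cconv (rlKernel μ) (mittagLefflerPDFReal μ l) =
      l • rlKernel μ := by
  funext x
  have hpos : ∀ k : ℕ, 0 < μ * ((k : ℝ) + 1) := fun k => by positivity
  have hint : ∀ (c : ℝ) (k : ℕ),
      ∫ t, rlKernel μ t * (c * rlKernel (μ * (k + 1)) (x - t)) =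
        c * rlKernel (μ * ((k + 1 : ℕ) + 1)) x := by
    intro c k
    have e := congrFun (cconv_rlKernel hμ (hpos k)) x
    rw [cconv_apply] at e
    have e2 : μ * (((k + 1 : ℕ) : ℝ) + 1) = μ + μ * (k + 1) := by
      push_cast
      ring
    rw [e2, ← e, ← integral_const_mul]
    congr 1
    funext t
    ring
  have hnorm : ∀ k : ℕ,
      ∫ t, ‖rlKernel μ t * (l * (-l) ^ k * rlKernel (μ * (k + 1)) (x - t))‖ =
        ‖l * (-l) ^ k‖ * rlKernel (μ * ((k + 1 : ℕ) + 1)) x := by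
    intro k
    rw [← hint]
    congr 1
    funext t
    rw [norm_mul, norm_mul, Real.norm_of_nonneg (rlKernel_nonneg hμ t),
      Real.norm_of_nonneg (rlKernel_nonneg (hpos k) _)]
  have hsum : Summable fun k : ℕ =>
      ∫ t, ‖rlKernel μ t * (l * (-l) ^ k * rlKernel (μ * (k + 1)) (x - t))‖ := by
    simp only [hnorm]
    -- With parameter -|l| the coefficients l(-l)^k all have one sign, so this series provides the
    -- absolute convergence.
    have h1 := (summable_nat_add_iff 1).2 (hasSum_rlKernel hμ (-|l|) x).summable
    rcases eq_or_ne l 0 with rfl | hl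
    · simp
    have hl' : |l| ≠ 0 := abs_ne_zero.2 hl
    refine (h1.mul_left (-|l|⁻¹)).congr fun k => ?_
    simp only [norm_mul, norm_pow, norm_neg, Real.norm_eq_abs, pow_succ, neg_neg]
    field_simp
  have h2 := hasSum_integral_of_summable_integral_norm
    (F := fun (k : ℕ) t => rlKernel μ t * (l * (-l) ^ k * rlKernel (μ * (k + 1)) (x - t)))
    (fun k => by
      refine (((causal_rlKernel hμ).integrable_mul_sub (causal_rlKernel (hpos k)) x).const_mul
        (l * (-l) ^ k)).congr (Eventually.of_forall fun t => ?_)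
      simp only
      ring) hsum
  simp only [hint] at h2
  have h3 : ∫ t, ∑' k : ℕ, rlKernel μ t * (l * (-l) ^ k * rlKernel (μ * (k + 1)) (x - t)) =
      cconv (rlKernel μ) (mittagLefflerPDFReal μ l) x := by
    rw [cconv_apply]
    congr 1
    funext t
    exact ((hasSum_rlKernel hμ l (x - t)).mul_left _).tsum_eq
  rw [h3] at h2
  -- Convolving with k_μ shifts the kernel series by one index; -l times the result is the series
  -- for h without its first term l k_μ.
  have h4 := (hasSum_nat_add_iff' 1).2 (hasSum_rlKernel hμ l x)
  have h5 := (h2.mul_left (-l)).unique (h4.congr_fun fun k => by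
    rw [pow_succ]
    ring)
  simp at h5
  simp only [Pi.add_apply, Pi.smul_apply, smul_eq_mul]
  linarith

/-! ### Initial values -/

/-- For μ < k, convolve the equation for h with k_(k-μ). For μ = k the operator is the identity and
the equation itself is the claim. -/
theorem Causal.rlOp_sub_nat_sends {h : ℝ → ℝ} (hh : Causal h) {μ l : ℝ} (hμ : 0 < μ)
    (e : h + l • cconv (rlKernel μ) h = l • rlKernel μ) {k : ℕ} (hk : μ ≤ k) (a : ℝ) :
    (rlOp (μ - k)).Sends (a • h) ((a * l) • (rlKernel k - cconv (rlKernel k) h)) := by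
  intro f' hf'
  rw [rlOp, if_neg (by linarith)]
  rcases hk.eq_or_lt with hk | hk
  · rw [if_pos (by linarith), ← hk]
    refine ⟨mem_univ _, hf'.trans fun t _ => ?_⟩
    have e' := congrFun e t
    simp only [Pi.smul_apply, smul_eq_mul, Pi.add_apply, Pi.sub_apply] at e' ⊢
    linear_combination a * e'
  · rw [if_neg (by linarith), neg_sub]
    have hs : 0 < (k : ℝ) - μ := by linarith
    refine ⟨(hh.smul a).rlIntegrable hs hf', (rlInt_eqOn_cconv hs (hh.smul a) hf').trans
      fun t _ => ?_⟩
    have e' := congrFun (congrArg (cconv (rlKernel (k - μ))) e) t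
    rw [(causal_rlKernel hs).cconv_add hh (((causal_rlKernel hμ).conv hh).smul l), cconv_smul,
      cconv_smul, hh.rlKernel_cconv_cconv hs hμ, cconv_rlKernel hs hμ, sub_add_cancel] at e'
    rw [cconv_smul]
    simp only [Pi.smul_apply, smul_eq_mul, Pi.add_apply, Pi.sub_apply] at e' ⊢
    linear_combination a * e'

theorem Causal.tendsto_rlKernel_one_sub_cconv {h : ℝ → ℝ} (hh : Causal h) :
    Tendsto (rlKernel (1 : ℕ) - cconv (rlKernel (1 : ℕ)) h) (𝓝[>] 0) (𝓝 1) := by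
  have h1 : Tendsto (fun t => 1 - cconv (rlKernel 1) h t) (𝓝[>] 0) (𝓝 1) := by
    simpa using tendsto_const_nhds.sub hh.tendsto_rlKernel_one_cconv
  refine h1.congr' ?_
  filter_upwards [self_mem_nhdsWithin] with t ht
  simp [rlKernel_one (mem_Ioi.1 ht)]

/-- Since k - 1 > 0, both terms are primitives of causal functions and vanish at 0. -/
theorem Causal.tendsto_rlKernel_nat_sub_cconv {h : ℝ → ℝ} (hh : Causal h) {k : ℕ} (hk : 2 ≤ k) :
    Tendsto (rlKernel k - cconv (rlKernel k) h) (𝓝[>] 0) (𝓝 0) := by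
  have hs : 0 < (k : ℝ) - 1 := by
    have : (2 : ℝ) ≤ k := by exact_mod_cast hk
    linarith
  have hc := causal_rlKernel hs
  have e : rlKernel k = cconv (rlKernel 1) (rlKernel (k - 1)) := by
    rw [cconv_rlKernel one_pos hs, add_sub_cancel]
  have e2 : cconv (rlKernel k) h = cconv (rlKernel 1) (cconv (rlKernel (k - 1)) h) := by
    rw [hh.rlKernel_cconv_cconv one_pos hs, add_sub_cancel]
  have h := hc.tendsto_rlKernel_one_cconv.sub (hc.conv hh).tendsto_rlKernel_one_cconv
  rw [sub_zero] at h
  rw [e2, e]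
  exact h

/-! ### Densities of sums of independent variables -/

section Density

variable {Ω : Type*} [MeasurableSpace Ω] {P : Measure Ω}

theorem HasDensity.congr_density {X : Ω → ℝ} {f g : ℝ → ℝ} (h : HasDensity X P f)
    (hfg : f =ᵐ[volume] g) : HasDensity X P g where
  aemeasurable := h.aemeasurable
  aemeasurable_density := h.aemeasurable_density.congr hfg
  nonneg := h.nonneg.trans_eq hfg
  map_eq := by
    rw [h.map_eq]
    exact withDensity_congr_ae (hfg.mono fun x hx => by simp only [hx])

theorem HasDensity.ae_eq {X : Ω → ℝ} {f g : ℝ → ℝ} (hf : HasDensity X P f)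
    (hg : HasDensity X P g) : f =ᵐ[volume] g := by
  have h := (withDensity_eq_iff_of_sigmaFinite hf.aemeasurable_density.ennreal_ofReal
    hg.aemeasurable_density.ennreal_ofReal).1 (hf.map_eq.symm.trans hg.map_eq)
  filter_upwards [h, hf.nonneg, hg.nonneg] with x hx h1 h2
  exact (ENNReal.ofReal_eq_ofReal_iff h1 h2).1 hx

/-- This transfers the results to an arbitrary continuous density, and makes the order of
convolution irrelevant. -/
theorem HasDensity.eqOn {X : Ω → ℝ} {f g : ℝ → ℝ} (hf : HasDensity X P f)
    (hg : HasDensity X P g) (hfc : ContinuousOn f (Ioi 0)) (hgc : ContinuousOn g (Ioi 0)) :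
    EqOn f g (Ioi 0) :=
  Measure.eqOn_open_of_ae_eq (ae_restrict_of_ae (hf.ae_eq hg)) isOpen_Ioi hfc hgc

/-- By continuity f = |f| everywhere on (0,∞), so `ENNReal.ofReal` is multiplicative at every point
of the convolution integrand. -/
theorem Causal.nonneg_of_ae {f : ℝ → ℝ} (hf : Causal f) (h : 0 ≤ᵐ[volume] f) (x : ℝ) :
    0 ≤ f x := by
  rcases le_or_gt x 0 with hx | hx
  · exact (hf.zero x hx).ge
  · have e : f =ᵐ[volume.restrict (Ioi 0)] fun x => |f x| :=
      ae_restrict_of_ae (h.mono fun x hx => (abs_of_nonneg hx).symm)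
    rw [Measure.eqOn_open_of_ae_eq e isOpen_Ioi hf.cont hf.cont.abs hx]
    exact abs_nonneg _

theorem HasDensity.add [IsFiniteMeasure P] {X Y : Ω → ℝ} {f g : ℝ → ℝ} (hX : HasDensity X P f)
    (hY : HasDensity Y P g) (hf : Causal f) (hg : Causal g) (hXY : IndepFun X Y P) :
    HasDensity (X + Y) P (cconv f g) where
  aemeasurable := hX.aemeasurable.add hY.aemeasurable
  aemeasurable_density := (hf.conv hg).loc.aestronglyMeasurable.aemeasurable
  nonneg := Eventually.of_forall fun x => integral_nonneg fun t =>
    mul_nonneg (hf.nonneg_of_ae hX.nonneg t) (hg.nonneg_of_ae hY.nonneg _)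
  map_eq := by
    rw [hXY.map_add_eq_map_conv_map₀ hX.aemeasurable hY.aemeasurable, hX.map_eq, hY.map_eq,
      conv_withDensity_eq_mlconvolution₀ hX.aemeasurable_density.ennreal_ofReal
        hY.aemeasurable_density.ennreal_ofReal]
    congr 1
    funext x
    rw [lconvolution_def, cconv_apply, ofReal_integral_eq_lintegral_ofReal
      (hf.integrable_mul_sub hg x) (Eventually.of_forall fun t =>
        mul_nonneg (hf.nonneg_of_ae hX.nonneg t) (hg.nonneg_of_ae hY.nonneg _))]
    refine lintegral_congr fun t => ?_
    rw [ENNReal.ofReal_mul (hf.nonneg_of_ae hX.nonneg t), neg_add_eq_sub]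

theorem hasDensity_sum_toFinset [IsFiniteMeasure P] {ι : Type*} [DecidableEq ι]
    {X : ι → Ω → ℝ} {d : ι → ℝ → ℝ} (hX : ∀ i, HasDensity (X i) P (d i))
    (hd : ∀ i, Causal (d i)) (hind : iIndepFun X P) :
    ∀ l : List ι, l.Nodup → l ≠ [] →
      HasDensity (∑ i ∈ l.toFinset, X i) P (cconvList (l.map d))
  | [], _, h => absurd rfl h
  | [i], _, _ => by simpa [cconvList] using hX i
  | i :: j :: l, hl, _ => by
    have hi := (List.nodup_cons.1 hl).1
    have ih := hasDensity_sum_toFinset hX hd hind (j :: l) (List.nodup_cons.1 hl).2 (by simp)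
    have hi' : i ∉ (j :: l).toFinset := by simpa using hi
    have hI := (hind.indepFun_finsetSum_of_notMem₀ (fun i => (hX i).aemeasurable) hi').symm
    rw [List.toFinset_cons, Finset.sum_insert hi']
    refine (hX i).add ih (hd i) (causal_cconvList fun f hf => ?_) hI
    rw [← List.map_cons] at hf
    obtain ⟨k, _, rfl⟩ := List.mem_map.1 hf
    exact hd k

end Density

/-! ### Assembling the operators and the main theorem -/

/-- The densities of the gamma summands followed by those of the Mittag-Leffler summands. -/
noncomputable def summandDensity {m n : ℕ} (r l₁ : Fin m → ℝ) (μ l₂ : Fin n → ℝ) :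
    Fin m ⊕ Fin n → ℝ → ℝ :=
  Sum.elim (fun i => gammaDensity (r i) (l₁ i)) fun j => mittagLefflerPDFReal (μ j) (l₂ j)

section Operators

variable {m n : ℕ} {r l₁ : Fin m → ℝ} {μ l₂ : Fin n → ℝ}

theorem causal_summandDensity (hr : ∀ i, 0 < r i) (hμ : ∀ j, 0 < μ j) (i : Fin m ⊕ Fin n) :
    Causal (summandDensity r l₁ μ l₂ i) := by
  cases i with
  | inl i => exact causal_gammaDensity (hr i) _
  | inr j => exact causal_mittagLefflerPDFReal (hμ j) _

theorem sends_leftComp_lfdo (hr : ∀ i, 0 < r i) (l : List (ℝ → ℝ)) (hl : ∀ f ∈ l, Causal f) :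
    (PartialOp.leftComp fun i => lfdo (l₁ i) (r i)).Sends
      (cconvList (List.ofFn (fun i => gammaDensity (r i) (l₁ i)) ++ l))
      ((∏ i, l₁ i ^ r i) • cconvList l) := by
  simpa using sends_leftComp (fun i => lfdo (l₁ i) (r i)) (fun i => gammaDensity (r i) (l₁ i))
    (fun i => l₁ i ^ r i) (fun i => causal_gammaDensity (hr i) _)
    (fun i => strips_lfdo (hr i) (l₁ i)) l hl 1

theorem sends_leftComp_addConst (hμ : ∀ j, 0 < μ j) (l : List (ℝ → ℝ))
    (hl : ∀ f ∈ l, Causal f) (a : ℝ) :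
    (PartialOp.leftComp fun j => (rlOp (μ j)).addConst (l₂ j)).Sends
      (a • cconvList (List.ofFn (fun j => mittagLefflerPDFReal (μ j) (l₂ j)) ++ l))
      ((a * ∏ j, l₂ j) • cconvList l) :=
  sends_leftComp _ _ _ (fun j => causal_mittagLefflerPDFReal (hμ j) _)
    (fun j => strips_addConst (causal_mittagLefflerPDFReal (hμ j) _) (hμ j)
      (mittagLefflerPDFReal_add_cconv (hμ j) _)) l hl a

theorem sends_opA (hr : ∀ i, 0 < r i) (hμ : ∀ j, 0 < μ j) :
    (opA r l₁ μ l₂).Sends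
      (cconvList ((List.ofFn Sum.inl ++ List.ofFn Sum.inr).map (summandDensity r l₁ μ l₂))) 0 := by
  have h1 := sends_leftComp_lfdo (l₁ := l₁) hr
    (List.ofFn fun j => mittagLefflerPDFReal (μ j) (l₂ j)) fun f hf => by
      obtain ⟨j, rfl⟩ := (List.mem_ofFn' _ _).1 hf
      exact causal_mittagLefflerPDFReal (hμ j) _
  have h2 := sends_leftComp_addConst (l₂ := l₂) hμ [] (by simp) (∏ i, l₁ i ^ r i)
  rw [List.append_nil] at h2
  have h3 := h1.comp h2
  rw [cconvList, smul_zero] at h3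
  rw [List.map_append, List.map_ofFn, List.map_ofFn]
  exact h3

/-- The summands, with the first Mittag-Leffler one moved to the end. -/
def summandsFirstLast (m : ℕ) {n : ℕ} (hn : 0 < n) : List (Fin m ⊕ Fin n) :=
  List.ofFn Sum.inl ++
    (List.ofFn (fun j : Fin (n - 1) => Sum.inr (⟨j + 1, by omega⟩ : Fin n)) ++
      [Sum.inr ⟨0, hn⟩])

theorem nodup_summandsFirstLast (m : ℕ) {n : ℕ} (hn : 0 < n) :
    (summandsFirstLast m hn).Nodup := by
  refine List.Nodup.append (List.nodup_ofFn.2 Sum.inl_injective)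
    (List.Nodup.append (List.nodup_ofFn.2 ?_) (List.nodup_singleton _) ?_) ?_
  · intro i j h
    simpa [Fin.ext_iff] using h
  · intro x
    simp only [List.mem_ofFn', List.mem_singleton]
    rintro ⟨j, rfl⟩ h
    simp at h
  · intro x
    simp only [List.mem_ofFn', List.mem_append, List.mem_singleton]
    rintro ⟨i, rfl⟩ h
    simp at h

theorem mem_summandsFirstLast (m : ℕ) {n : ℕ} (hn : 0 < n) (i : Fin m ⊕ Fin n) :
    i ∈ summandsFirstLast m hn := by
  simp only [summandsFirstLast, List.mem_append, List.mem_ofFn', List.mem_singleton, mem_range]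
  rcases i with i | ⟨j, hj⟩
  · exact Or.inl ⟨i, rfl⟩
  · rcases j with _ | j
    · exact Or.inr (Or.inr rfl)
    · exact Or.inr (Or.inl ⟨⟨j, by omega⟩, rfl⟩)

theorem sends_opInit (hn : 0 < n) (hr : ∀ i, 0 < r i) (hμ : ∀ j, 0 < μ j) {k : ℕ}
    (hk : μ ⟨0, hn⟩ ≤ k) :
    (opInit hn r l₁ μ l₂ k).Sends
      (cconvList ((summandsFirstLast m hn).map (summandDensity r l₁ μ l₂)))
      (((∏ i, l₁ i ^ r i) * ∏ j, l₂ j) •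
        (rlKernel k - cconv (rlKernel k) (mittagLefflerPDFReal (μ ⟨0, hn⟩) (l₂ ⟨0, hn⟩)))) := by
  have hc := causal_mittagLefflerPDFReal (hμ ⟨0, hn⟩) (l₂ ⟨0, hn⟩)
  have h1 := sends_leftComp_lfdo (l₁ := l₁) hr
    (List.ofFn (fun j : Fin (n - 1) => mittagLefflerPDFReal (μ ⟨j + 1, by omega⟩)
      (l₂ ⟨j + 1, by omega⟩)) ++ [mittagLefflerPDFReal (μ ⟨0, hn⟩) (l₂ ⟨0, hn⟩)]) fun f hf => by
      rcases List.mem_append.1 hf with hf | hf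
      · obtain ⟨j, rfl⟩ := (List.mem_ofFn' _ _).1 hf
        exact causal_mittagLefflerPDFReal (hμ _) _
      · rw [List.mem_singleton.1 hf]
        exact hc
  have h2 := sends_leftComp_addConst (μ := fun j : Fin (n - 1) => μ ⟨j + 1, by omega⟩)
    (l₂ := fun j : Fin (n - 1) => l₂ ⟨j + 1, by omega⟩) (fun j => hμ _)
    [mittagLefflerPDFReal (μ ⟨0, hn⟩) (l₂ ⟨0, hn⟩)] (by simpa using hc) (∏ i, l₁ i ^ r i)
  have h3 := (h1.comp h2).comp (hc.rlOp_sub_nat_sends (hμ _)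
    (mittagLefflerPDFReal_add_cconv (hμ _) _) hk _)
  have e : (∏ j : Fin (n - 1), l₂ ⟨j + 1, by omega⟩) * l₂ ⟨0, hn⟩ = ∏ j, l₂ j := by
    obtain ⟨n, rfl⟩ := Nat.exists_eq_succ_of_ne_zero hn.ne'
    rw [Fin.prod_univ_succ, mul_comm]
    rfl
  rw [mul_assoc, e] at h3
  rw [summandsFirstLast, List.map_append, List.map_append, List.map_ofFn, List.map_ofFn]
  exact h3

end Operators

theorem theorem1 {Ω : Type*} [MeasurableSpace Ω] (P : Measure Ω) [IsProbabilityMeasure P]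
    (m n : ℕ) (hmn : 0 < m + n)
    (r l₁ : Fin m → ℝ) (μ l₂ : Fin n → ℝ)
    (hr : ∀ i, 0 < r i) (hl₁ : ∀ i, 0 < l₁ i)
    (hμ : ∀ j, 0 < μ j ∧ μ j ≤ 1) (hl₂ : ∀ j, 0 < l₂ j)
    (Y : Fin m → Ω → ℝ) (Z : Fin n → Ω → ℝ)
    (hY : ∀ i, HasDensity (Y i) P (gammaPDFReal (r i) (l₁ i)))
    (hZ : ∀ j, HasDensity (Z j) P (mittagLefflerPDFReal (μ j) (l₂ j)))
    (hindep : iIndepFun (Sum.elim Y Z) P)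
    (T : Ω → ℝ) (hT : ∀ ω, T ω = ∑ i, Y i ω + ∑ j, Z j ω) :
    (∃ f : ℝ → ℝ, HasDensity T P f ∧ ContinuousOn f (Ioi 0)) ∧
    ∀ f : ℝ → ℝ, HasDensity T P f → ContinuousOn f (Ioi 0) →
      (f ∈ (opA r l₁ μ l₂).dom ∧ ∀ t : ℝ, 0 < t → (opA r l₁ μ l₂).act f t = 0) ∧
      ∀ hn : 0 < n,
        (f ∈ (opInit hn r l₁ μ l₂ 1).dom ∧
          Tendsto ((opInit hn r l₁ μ l₂ 1).act f) (𝓝[>] 0)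
            (𝓝 ((∏ i, l₁ i ^ r i) * ∏ j, l₂ j))) ∧
        ∀ k : ℕ, 2 ≤ k → k ≤ ⌈∑ j, μ j + ∑ i, r i⌉₊ →
          f ∈ (opInit hn r l₁ μ l₂ k).dom ∧
          Tendsto ((opInit hn r l₁ μ l₂ k).act f) (𝓝[>] 0) (𝓝 0) := by
  set d := summandDensity r l₁ μ l₂
  have hd : ∀ i, Causal (d i) := causal_summandDensity hr fun j => (hμ j).1
  have hX : ∀ i, HasDensity (Sum.elim Y Z i) P (d i) := by
    rintro (i | j)
    exacts [(hY i).congr_density (gammaDensity_ae_eq _ _), hZ j]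
  have hT' : ∑ i, Sum.elim Y Z i = T := by
    funext ω
    simp [hT, Fintype.sum_sum_type]
  have density : ∀ l : List (Fin m ⊕ Fin n), l.Nodup → (∀ i, i ∈ l) →
      HasDensity T P (cconvList (l.map d)) ∧ ContinuousOn (cconvList (l.map d)) (Ioi 0) := by
    intro l hl hall
    have hne : l ≠ [] := by
      rintro rfl
      rcases Nat.eq_zero_or_pos m with h | h
      · exact List.not_mem_nil (hall (Sum.inr ⟨0, by omega⟩))
      · exact List.not_mem_nil (hall (Sum.inl ⟨0, h⟩))
    have hu : l.toFinset = Finset.univ := by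
      ext i
      simp [hall i]
    have h := hasDensity_sum_toFinset hX hd hindep l hl hne
    rw [hu, hT'] at h
    refine ⟨h, (causal_cconvList fun f hf => ?_).cont⟩
    obtain ⟨i, _, rfl⟩ := List.mem_map.1 hf
    exact hd i
  obtain ⟨hF, hFc⟩ := density (List.ofFn Sum.inl ++ List.ofFn Sum.inr)
    (List.Nodup.append (List.nodup_ofFn.2 Sum.inl_injective)
      (List.nodup_ofFn.2 Sum.inr_injective) (by
        intro x
        simp only [List.mem_ofFn', mem_range]
        rintro ⟨i, rfl⟩ ⟨j, hj⟩
        cases hj))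
    (by rintro (i | j) <;> simp [List.mem_ofFn'])
  refine ⟨⟨_, hF, hFc⟩, fun f hf hfc => ⟨?_, fun hn => ?_⟩⟩
  · exact sends_opA hr (fun j => (hμ j).1) f (hf.eqOn hF hfc hFc)
  -- The same density, convolved in the order that keeps the first Mittag-Leffler factor until the
  -- end.
  obtain ⟨hG, hGc⟩ := density _ (nodup_summandsFirstLast m hn) (mem_summandsFirstLast m hn)
  have hfG := hf.eqOn hG hfc hGc
  have hc := causal_mittagLefflerPDFReal (hμ ⟨0, hn⟩).1 (l₂ ⟨0, hn⟩)
  have main : ∀ k : ℕ, 1 ≤ k → ∀ y : ℝ, Tendsto (rlKernel k - cconv (rlKernel k)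
      (mittagLefflerPDFReal (μ ⟨0, hn⟩) (l₂ ⟨0, hn⟩))) (𝓝[>] 0) (𝓝 y) →
      f ∈ (opInit hn r l₁ μ l₂ k).dom ∧ Tendsto ((opInit hn r l₁ μ l₂ k).act f) (𝓝[>] 0)
        (𝓝 (((∏ i, l₁ i ^ r i) * ∏ j, l₂ j) * y)) := by
    intro k hk y hy
    -- Here μ ≤ 1 enters: the order μ - k is never positive, so no derivative is taken in the last
    -- step.
    have hk' : μ ⟨0, hn⟩ ≤ k := (hμ _).2.trans (by exact_mod_cast hk)
    obtain ⟨h1, h2⟩ := sends_opInit hn hr (fun j => (hμ j).1) hk' f hfG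
    refine ⟨h1, (hy.const_mul _).congr' ?_⟩
    filter_upwards [self_mem_nhdsWithin] with t ht
    exact (h2 ht).symm
  refine ⟨?_, fun k hk _ => ?_⟩
  · simpa using main 1 le_rfl 1 hc.tendsto_rlKernel_one_sub_cconv
  · simpa using main k (by omega) 0 (hc.tendsto_rlKernel_nat_sub_cconv hk)
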